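/- Let $n,d\in\mathbb N$, $X\in\mathbb R^{n\times d}$, $0\neq y\in\mathbb R^n$ and $\beta>0$. For $g\in\mathbb R^d$ put $D(g)=\mathrm{diag}(\mathbb 1[Xg\ge 0])$, let $$\mathcal M=\mathbb E_{g\sim\mathcal N(0,I_d)}\big[D(g)XX^TD(g)\big],\qquad \kappa=\frac{\lambda_{\max}(XX^T)}{\lambda_{\min}(\mathcal M)},$$ and assume that $\mathcal M$ is invertible. For $\tilde P\in\mathbb N$ and $g_1,\dots,g_{\tilde P}\in\mathbb R^d$ write $\tilde D_i=D(g_i)$, $\mathcal M_{\tilde P}=\frac1{\tilde P}\sum_{i=1}^{\tilde P}\tilde D_iXX^T\tilde D_i$ (with $\tilde P\mathcal M_{\tilde P}=0$ if $\tilde P=0$), and $$p_2^*=\min_{u_1,\dots,u_{\tilde P}\in\mathbb R^d}\ \frac12\Big\|\sum_{i=1}^{\tilde P}\tilde D_iXu_i-y\Big\|_2^2+\frac\beta2\sum_{i=1}^{\tilde P}\|u_i\|_2^2 .$$ Then: 1. For all $\tilde P$ and all $g_1,\dots,g_{\tilde P}$ the minimum is attained, $\beta I+\tilde P\mathcal M_{\tilde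 P}$ is invertible, and $p_2^*=\frac\beta2\,y^T(\beta I+\tilde P\mathcal M_{\tilde P})^{-1}y$. 2. There exist constants $C_1,C_2>0$, depending only on $X$, $y$ and $\beta$, such that for all $\delta\in(0,1)$ and all integers $\tilde P\ge 12\,\kappa\log(2n/\delta)$, if $g_1,\dots,g_{\tilde P}$ are independent $\mathcal N(0,I_d)$ random vectors, then with probability at least $1-\delta$ $$\frac{C_1}{\tilde P}\le p_2^*\le\frac{C_2}{\tilde P}.$$ -/

import Mathlib

open MeasureTheory ProbabilityTheory
open scoped Matrix

namespace GatedRelu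

noncomputable section

variable {n d P : ℕ}

/-- The hyperplane arrangement pattern `diag(1[X g ≥ 0])` of the gate vector `g`. -/
def pattern (X : Matrix (Fin n) (Fin d) ℝ) (g : EuclideanSpace ℝ (Fin d)) :
    Matrix (Fin n) (Fin n) ℝ :=
  Matrix.diagonal fun i => if 0 ≤ (X *ᵥ g.ofLp) i then 1 else 0

/-- The masked Gram matrix `D X Xᵀ D`, where `D` is the pattern of `g`. -/
def maskedGram (X : Matrix (Fin n) (Fin d) ℝ) (g : EuclideanSpace ℝ (Fin d)) :
    Matrix (Fin n) (Fin n) ℝ :=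
  pattern X g * (X * Xᵀ) * pattern X g

/-- The matrix `M = E[D X Xᵀ D]` for `g ∼ N(0, I_d)`, the expectation being taken entrywise
(each entry is a bounded measurable function of `g`). -/
def expectedGram (X : Matrix (Fin n) (Fin d) ℝ) : Matrix (Fin n) (Fin n) ℝ :=
  Matrix.of fun i j => ∫ g, maskedGram X g i j ∂(stdGaussian (EuclideanSpace ℝ (Fin d)))

/-- The sample mean `M_P = (1/P) ∑ᵢ Dᵢ X Xᵀ Dᵢ`. -/
def sampleGram (X : Matrix (Fin n) (Fin d) ℝ) (g : Fin P → EuclideanSpace ℝ (Fin d)) :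
    Matrix (Fin n) (Fin n) ℝ :=
  (1 / (P : ℝ)) • ∑ i, maskedGram X (g i)

/-- The largest eigenvalue of a real symmetric matrix of positive size. -/
def lambdaMax (A : Matrix (Fin n) (Fin n) ℝ) : ℝ := sSup (spectrum ℝ A)

/-- The smallest eigenvalue of a real symmetric matrix of positive size. -/
def lambdaMin (A : Matrix (Fin n) (Fin n) ℝ) : ℝ := sInf (spectrum ℝ A)

/-- The condition-type number `κ = λ_max(X Xᵀ) / λ_min(M)`, meaningful when `M` is invertible. -/
def kappa (X : Matrix (Fin n) (Fin d) ℝ) : ℝ :=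
  lambdaMax (X * Xᵀ) / lambdaMin (expectedGram X)

/-- The objective `½ ‖∑ᵢ Dᵢ X uᵢ - y‖² + (β/2) ∑ᵢ ‖uᵢ‖²` of the unconstrained relaxed problem with
`ℓ²` regularization; all norms are Euclidean. -/
def l2Objective (X : Matrix (Fin n) (Fin d) ℝ) (y : EuclideanSpace ℝ (Fin n)) (β : ℝ)
    (g : Fin P → EuclideanSpace ℝ (Fin d)) (u : Fin P → EuclideanSpace ℝ (Fin d)) : ℝ :=
  (1 / 2) * ‖(∑ i, WithLp.toLp 2 ((pattern X (g i) * X) *ᵥ (u i).ofLp)) - y‖ ^ 2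
    + (β / 2) * ∑ i, ‖u i‖ ^ 2

/-- The optimal value `p₂* = inf_u` of the `ℓ²`-regularized objective. -/
def l2OptVal (X : Matrix (Fin n) (Fin d) ℝ) (y : EuclideanSpace ℝ (Fin n)) (β : ℝ)
    (g : Fin P → EuclideanSpace ℝ (Fin d)) : ℝ :=
  ⨅ u : Fin P → EuclideanSpace ℝ (Fin d), l2Objective X y β g u

end

end GatedRelu

/-! Part 1 is ridge duality. Completing squares gives, for every `z`, a lower bound on the
objective; at `z = (β I + ∑ Dᵢ X Xᵀ Dᵢ)⁻¹ y` it is attained by `uᵢ = Xᵀ Dᵢ z`.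

For part 2 write `R = λ_max(X Xᵀ)` and `lam = λ_min(M)`. Weak duality at a multiple of `y` gives the
lower bound for every sample. The upper bound needs `∑ ‖Xᵀ Dᵢ z‖² ≥ c P ‖z‖²` with high probability.
Since `c` may be any constant depending on `X`, no matrix Chernoff bound is needed: there are
finitely many patterns, so every set of patterns with trivial common kernel contributes at least a
uniform `c₀ ‖z‖²`. It suffices that the sample splits into at least order `P` consecutive blocks
with trivial common kernel.

To count blocks, follow the dimension of the common kernel of the current block. One more sample
shrinks it in mean by the factor `1 - lam/R`. Weighting each completed block by a small `t` makes
the expectation of `t ^ (number of blocks)` decay like `(1 - lam/(2R)) ^ P`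
(`sum_prod_mul_pow_restartCount_le`), and Markov's inequality bounds the probability of few blocks
(`exists_pos_sum_prod_filter_le`). -/

namespace GatedRelu

/-! ### Lower tail for sums of random operators with finitely many values -/

section KernelProcess

variable {E F α : Type*} [NormedAddCommGroup E] [InnerProductSpace ℝ E]
  [NormedAddCommGroup F] [NormedSpace ℝ F]

/-- The common kernel of the operators indexed by `S`. -/
def commonKer (L : α → E →ₗ[ℝ] F) (S : Finset α) : Submodule ℝ E :=
  ⨅ a ∈ S, LinearMap.ker (L a)

open Classical in
theorem commonKer_insert (L : α → E →ₗ[ℝ] F) (S : Finset α) (a : α) :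
    commonKer L (insert a S) = commonKer L S ⊓ LinearMap.ker (L a) := by
  simp only [commonKer, Finset.mem_insert, iInf_or, iInf_inf_eq, iInf_iInf_eq_left]
  exact inf_comm _ _

theorem commonKer_empty (L : α → E →ₗ[ℝ] F) : commonKer L ∅ = ⊤ := by
  simp [commonKer]

open Classical in
/-- Starting from the set `S` of indices already seen, the number of times the indices seen since
the last restart have trivial common kernel; each such time the process is restarted. -/
noncomputable def restartCount (L : α → E →ₗ[ℝ] F) : (P : ℕ) → Finset α → (Fin P → α) → ℕ
  | 0, _, _ => 0
  | P + 1, S, s =>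
    if commonKer L (insert (s 0) S) = ⊥ then restartCount L P ∅ (Fin.tail s) + 1
    else restartCount L P (insert (s 0) S) (Fin.tail s)

/-- Completed blocks are disjoint stretches of the sequence, and each contributes at least `c ‖x‖²`.
Repeats inside a block only increase the right side. -/
theorem restartCount_mul_le (L : α → E →ₗ[ℝ] F) {c : ℝ}
    (hc : ∀ S : Finset α, commonKer L S = ⊥ → ∀ x, c * ‖x‖ ^ 2 ≤ ∑ a ∈ S, ‖L a x‖ ^ 2)
    (P : ℕ) (S : Finset α) (s : Fin P → α) (x : E) :
    restartCount L P S s * (c * ‖x‖ ^ 2) ≤ ∑ a ∈ S, ‖L a x‖ ^ 2 + ∑ i, ‖L (s i) x‖ ^ 2 := by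
  classical
  induction P generalizing S with
  | zero => simpa [restartCount] using Finset.sum_nonneg fun _ _ => sq_nonneg _
  | succ P ih =>
    have hins : ∑ a ∈ insert (s 0) S, ‖L a x‖ ^ 2 ≤ ‖L (s 0) x‖ ^ 2 + ∑ a ∈ S, ‖L a x‖ ^ 2 := by
      by_cases h : s 0 ∈ S
      · rw [Finset.insert_eq_of_mem h]; linarith [sq_nonneg ‖L (s 0) x‖]
      · rw [Finset.sum_insert h]
    rw [Fin.sum_univ_succ]
    simp only [restartCount]
    split_ifs with h
    · have h1 := ih ∅ (Fin.tail s)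
      have h2 := hc _ h x
      simp only [Finset.sum_empty, zero_add, Fin.tail] at h1
      push_cast
      linarith
    · have h1 := ih (insert (s 0) S) (Fin.tail s)
      simp only [Fin.tail] at h1
      linarith

variable [FiniteDimensional ℝ E]

/-- The joint map `x ↦ (L a x)` is injective on a finite-dimensional space, hence bounded below. -/
theorem exists_pos_le_sum_norm_sq (L : α → E →ₗ[ℝ] F) (S : Finset α) (hS : commonKer L S = ⊥) :
    ∃ c : ℝ, 0 < c ∧ ∀ x, c * ‖x‖ ^ 2 ≤ ∑ a ∈ S, ‖L a x‖ ^ 2 := by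
  let T : E →ₗ[ℝ] (S → F) := LinearMap.pi fun a => L a
  have hT : LinearMap.ker T = ⊥ := by
    rw [LinearMap.ker_pi, ← hS, commonKer, iInf_subtype']
  obtain ⟨K, hK, hanti⟩ := T.exists_antilipschitzWith hT
  have hK' : (0 : ℝ) < K := hK
  refine ⟨((K : ℝ) ^ 2)⁻¹, by positivity, fun x => ?_⟩
  have h1 : ‖x‖ ≤ K * ‖T x‖ := by
    simpa using hanti.le_mul_dist x 0
  have h2 : ‖T x‖ ^ 2 ≤ ∑ a ∈ S, ‖L a x‖ ^ 2 := by
    have h0 : 0 ≤ ∑ a ∈ S, ‖L a x‖ ^ 2 := Finset.sum_nonneg fun _ _ => sq_nonneg _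
    refine (Real.le_sqrt (norm_nonneg _) h0).mp ?_
    refine (pi_norm_le_iff_of_nonneg (Real.sqrt_nonneg _)).mpr fun a => ?_
    refine (Real.le_sqrt (norm_nonneg _) h0).mpr ?_
    exact Finset.single_le_sum (f := fun a => ‖L a x‖ ^ 2) (fun _ _ => sq_nonneg _) a.2
  refine le_trans ?_ h2
  rw [inv_mul_le_iff₀ (by positivity), ← mul_pow]
  exact pow_le_pow_left₀ (norm_nonneg _) h1 2

theorem sum_norm_sq_starProjection {ι : Type*} [Fintype ι] (b : OrthonormalBasis ι ℝ E)
    (K : Submodule ℝ E) :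
    ∑ i, ‖K.starProjection (b i)‖ ^ 2 = Module.finrank ℝ K := by
  have hproj : LinearMap.IsProj K (K.starProjection : E →ₗ[ℝ] E) :=
    ⟨fun x => K.starProjection_apply_mem x,
      fun x hx => Submodule.starProjection_eq_self_iff.mpr hx⟩
  rw [← hproj.trace, LinearMap.trace_eq_sum_inner _ b]
  refine Finset.sum_congr rfl fun i _ => ?_
  have h : inner ℝ (K.starProjection (b i)) (b i) = ‖K.starProjection (b i)‖ ^ 2 :=
    K.re_inner_starProjection_eq_normSq (b i)
  rw [← h, real_inner_comm]
  rfl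

/-- On `K`, only the component orthogonal to `K ⊓ ker L` survives `L`; the trace of the projection
onto that complement in `K` is the difference of dimensions. -/
theorem sum_norm_sq_map_starProjection_le {ι : Type*} [Fintype ι] (b : OrthonormalBasis ι ℝ E)
    (K : Submodule ℝ E) (L : E →ₗ[ℝ] F) {R : ℝ} (hL : ∀ x, ‖L x‖ ^ 2 ≤ R * ‖x‖ ^ 2) :
    ∑ i, ‖L (K.starProjection (b i))‖ ^ 2 ≤
      R * (Module.finrank ℝ K - Module.finrank ℝ ↥(K ⊓ LinearMap.ker L)) := by
  set K' := K ⊓ LinearMap.ker L with hK'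
  rw [← sum_norm_sq_starProjection b, ← sum_norm_sq_starProjection b, ← Finset.sum_sub_distrib,
    Finset.mul_sum]
  refine Finset.sum_le_sum fun i _ => ?_
  have hcomp : K'.starProjection (K.starProjection (b i)) = K'.starProjection (b i) :=
    DFunLike.congr_fun
      (Submodule.starProjection_comp_starProjection_of_le (inf_le_left : K' ≤ K)) (b i)
  have hpyth := Submodule.norm_sq_eq_add_norm_sq_starProjection (𝕜 := ℝ) (K.starProjection (b i)) K'
  rw [hcomp, Submodule.starProjection_orthogonal_val, hcomp] at hpyth
  have hker : L (K'.starProjection (b i)) = 0 := (K'.starProjection_apply_mem (b i)).2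
  have hmap := hL (K.starProjection (b i) - K'.starProjection (b i))
  rw [map_sub, hker, sub_zero] at hmap
  rw [hpyth]
  linarith

variable [Fintype α]

/-- Averaging over a random operator shrinks a subspace, intersected with the kernel, by a constant
factor in expected dimension. -/
theorem sum_mul_finrank_inf_ker_le (p : α → ℝ) (hp : ∀ a, 0 ≤ p a) (hp1 : ∑ a, p a = 1)
    (L : α → E →ₗ[ℝ] F) {R lam : ℝ} (hR : 0 < R) (hL : ∀ a x, ‖L a x‖ ^ 2 ≤ R * ‖x‖ ^ 2)
    (hlam : ∀ x, lam * ‖x‖ ^ 2 ≤ ∑ a, p a * ‖L a x‖ ^ 2) (K : Submodule ℝ E) :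
    ∑ a, p a * (Module.finrank ℝ ↥(K ⊓ LinearMap.ker (L a)) : ℝ) ≤
      (1 - lam / R) * Module.finrank ℝ K := by
  let b := stdOrthonormalBasis ℝ E
  have h1 : lam * Module.finrank ℝ K ≤
      ∑ a, p a * (R * (Module.finrank ℝ K - Module.finrank ℝ ↥(K ⊓ LinearMap.ker (L a)))) := by
    calc lam * Module.finrank ℝ K = ∑ i, lam * ‖K.starProjection (b i)‖ ^ 2 := by
          rw [← Finset.mul_sum, sum_norm_sq_starProjection]
      _ ≤ ∑ i, ∑ a, p a * ‖L a (K.starProjection (b i))‖ ^ 2 :=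
          Finset.sum_le_sum fun i _ => hlam _
      _ = ∑ a, p a * ∑ i, ‖L a (K.starProjection (b i))‖ ^ 2 := by
          rw [Finset.sum_comm]; simp_rw [Finset.mul_sum]
      _ ≤ _ := Finset.sum_le_sum fun a _ => mul_le_mul_of_nonneg_left
          (sum_norm_sq_map_starProjection_le b K (L a) (hL a)) (hp a)
  have h2 : ∑ a, p a * (R * (Module.finrank ℝ K - Module.finrank ℝ ↥(K ⊓ LinearMap.ker (L a)))) =
      R * (Module.finrank ℝ K - ∑ a, p a * (Module.finrank ℝ ↥(K ⊓ LinearMap.ker (L a)) : ℝ)) := by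
    have h3 : ∑ a, p a * (R * Module.finrank ℝ K) = R * Module.finrank ℝ K := by
      rw [← Finset.sum_mul, hp1, one_mul]
    rw [mul_sub, ← h3, Finset.mul_sum, ← Finset.sum_sub_distrib]
    exact Finset.sum_congr rfl fun a _ => by ring
  rw [h2, ← div_le_iff₀' hR] at h1
  have : lam * Module.finrank ℝ K / R = lam / R * Module.finrank ℝ K := by ring
  linarith

theorem sum_fin_succ_fun {M : Type*} [AddCommMonoid M] {P : ℕ} (f : (Fin (P + 1) → α) → M) :
    ∑ s, f s = ∑ a, ∑ s : Fin P → α, f (Fin.cons a s) := by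
  rw [← Fintype.sum_prod_type' fun a s => f (Fin.cons a s)]
  exact ((Fin.consEquiv fun _ => α).sum_comp f).symm

/-- The potential is `t ^ restarts` times the dimension of the current common kernel. A restart
resets the dimension from `0` to `finrank E` but costs a factor `t`, chosen so that `t * finrank E =
lam / (2R)`. As the current dimension is at least `1`, this uses up at most half of the mean
decrease `lam / R`. -/
theorem sum_prod_mul_pow_restartCount_le [Nontrivial E] (p : α → ℝ) (hp : ∀ a, 0 ≤ p a)
    (hp1 : ∑ a, p a = 1) (L : α → E →ₗ[ℝ] F) {R lam : ℝ} (hR : 0 < R) (hlam0 : 0 < lam)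
    (hle : lam ≤ R) (hL : ∀ a x, ‖L a x‖ ^ 2 ≤ R * ‖x‖ ^ 2)
    (hlam : ∀ x, lam * ‖x‖ ^ 2 ≤ ∑ a, p a * ‖L a x‖ ^ 2) (P : ℕ) (S : Finset α)
    (hS : commonKer L S ≠ ⊥) :
    ∑ s : Fin P → α, (∏ i, p (s i)) *
        (lam / (2 * Module.finrank ℝ E * R)) ^ restartCount L P S s ≤
      (1 - lam / (2 * R)) ^ P * Module.finrank ℝ (commonKer L S) := by
  classical
  set t : ℝ := lam / (2 * Module.finrank ℝ E * R) with ht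
  have hn : (0 : ℝ) < Module.finrank ℝ E := by exact_mod_cast Module.finrank_pos
  have ht0 : 0 < t := by positivity
  have htn : t * Module.finrank ℝ E = lam / (2 * R) := by rw [ht]; field_simp
  have hρ : 0 ≤ 1 - lam / (2 * R) := by
    rw [sub_nonneg, div_le_one (by positivity)]; linarith
  have hdim : ∀ S : Finset α, commonKer L S ≠ ⊥ →
      (1 : ℝ) ≤ Module.finrank ℝ (commonKer L S) := fun S hS => by
    exact_mod_cast Nat.one_le_iff_ne_zero.mpr fun h => hS (Submodule.finrank_eq_zero.mp h)
  induction P generalizing S with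
  | zero => simpa [restartCount] using hdim S hS
  | succ P ih =>
    rw [sum_fin_succ_fun]
    have hstep : ∀ a, ∑ s : Fin P → α, (∏ i, p ((Fin.cons a s : Fin (P + 1) → α) i)) *
          t ^ restartCount L (P + 1) S (Fin.cons a s) ≤
        (1 - lam / (2 * R)) ^ P *
          (p a * Module.finrank ℝ ↥(commonKer L S ⊓ LinearMap.ker (L a)) +
            p a * (lam / (2 * R))) := by
      intro a
      simp only [Fin.prod_univ_succ, Fin.cons_zero, Fin.cons_succ, restartCount, Fin.tail_cons]
      rw [← mul_add, ← commonKer_insert]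
      by_cases h : commonKer L (insert a S) = ⊥
      · simp only [h, if_true]
        have := ih ∅ (by rw [commonKer_empty]; exact top_ne_bot)
        rw [commonKer_empty, finrank_top] at this
        calc _ = p a * t * ∑ s : Fin P → α, (∏ i, p (s i)) * t ^ restartCount L P ∅ s := by
              rw [Finset.mul_sum]
              exact Finset.sum_congr rfl fun s _ => by ring
          _ ≤ p a * t * ((1 - lam / (2 * R)) ^ P * Module.finrank ℝ E) :=
              mul_le_mul_of_nonneg_left this (mul_nonneg (hp a) ht0.le)
          _ = _ := by
              rw [h, finrank_bot, ← htn]; push_cast; ring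
      · simp only [h, if_false]
        calc _ = p a * ∑ s : Fin P → α,
                (∏ i, p (s i)) * t ^ restartCount L P (insert a S) s := by
              rw [Finset.mul_sum]
              exact Finset.sum_congr rfl fun s _ => by ring
          _ ≤ p a * ((1 - lam / (2 * R)) ^ P * Module.finrank ℝ (commonKer L (insert a S))) :=
              mul_le_mul_of_nonneg_left (ih _ h) (hp a)
          _ ≤ _ := by
              have : 0 ≤ (1 - lam / (2 * R)) ^ P * (p a * (lam / (2 * R))) :=
                mul_nonneg (pow_nonneg hρ P) (mul_nonneg (hp a) (by positivity))
              linarith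
    refine (Finset.sum_le_sum fun a _ => hstep a).trans ?_
    rw [← Finset.mul_sum, Finset.sum_add_distrib, ← Finset.sum_mul, hp1, one_mul, pow_succ,
      mul_assoc]
    refine mul_le_mul_of_nonneg_left ?_ (pow_nonneg hρ P)
    have h1 := sum_mul_finrank_inf_ker_le p hp hp1 L hR hL hlam (commonKer L S)
    have h2 : lam / (2 * R) ≤ lam / (2 * R) * Module.finrank ℝ (commonKer L S) :=
      le_mul_of_one_le_right (by positivity) (hdim S hS)
    have h3 : lam / R = lam / (2 * R) + lam / (2 * R) := by field_simp; norm_num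
    rw [h3] at h1
    linarith

/-- There are only finitely many sets `S`, so the smallest of their constants works. -/
theorem exists_uniform_pos_le_sum_norm_sq (L : α → E →ₗ[ℝ] F) :
    ∃ c : ℝ, 0 < c ∧ ∀ S : Finset α, commonKer L S = ⊥ →
      ∀ x, c * ‖x‖ ^ 2 ≤ ∑ a ∈ S, ‖L a x‖ ^ 2 := by
  classical
  have h : ∀ S : Finset α, ∃ c : ℝ, 0 < c ∧ (commonKer L S = ⊥ →
      ∀ x, c * ‖x‖ ^ 2 ≤ ∑ a ∈ S, ‖L a x‖ ^ 2) := fun S => by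
    by_cases hS : commonKer L S = ⊥
    · obtain ⟨c, hc, h⟩ := exists_pos_le_sum_norm_sq L S hS
      exact ⟨c, hc, fun _ => h⟩
    · exact ⟨1, one_pos, fun h => absurd h hS⟩
  choose c hc h using h
  obtain ⟨S₀, hS₀⟩ := Finite.exists_min c
  exact ⟨c S₀, hc S₀, fun S hS x =>
    (mul_le_mul_of_nonneg_right (hS₀ S) (sq_nonneg _)).trans (h S hS x)⟩

open Classical in
/-- A lower-tail bound for sums of independent, identically distributed positive semidefinite
operators with finitely many values, up to an unspecified constant. -/
theorem exists_pos_sum_prod_filter_le [Nontrivial E] (p : α → ℝ) (hp : ∀ a, 0 ≤ p a)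
    (hp1 : ∑ a, p a = 1) (L : α → E →ₗ[ℝ] F) {R lam : ℝ} (hR : 0 < R) (hlam0 : 0 < lam)
    (hle : lam ≤ R) (hL : ∀ a x, ‖L a x‖ ^ 2 ≤ R * ‖x‖ ^ 2)
    (hlam : ∀ x, lam * ‖x‖ ^ 2 ≤ ∑ a, p a * ‖L a x‖ ^ 2) :
    ∃ c : ℝ, 0 < c ∧ ∀ P : ℕ,
      ∑ s : Fin P → α with ¬ ∀ x, c * P * ‖x‖ ^ 2 ≤ ∑ i, ‖L (s i) x‖ ^ 2, ∏ i, p (s i) ≤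
        Module.finrank ℝ E * Real.exp (-(P * (lam / (4 * R)))) := by
  obtain ⟨c₀, hc₀, hc⟩ := exists_uniform_pos_le_sum_norm_sq L
  have hn : (1 : ℝ) ≤ Module.finrank ℝ E := by
    exact_mod_cast Nat.one_le_iff_ne_zero.mpr Module.finrank_pos.ne'
  set t : ℝ := lam / (2 * Module.finrank ℝ E * R) with ht
  have ht0 : 0 < t := by positivity
  have ht1 : t < 1 := by
    rw [ht, div_lt_one (by positivity)]
    nlinarith [mul_le_mul_of_nonneg_right hn hR.le]
  have hlog : 0 < -Real.log t := neg_pos.mpr (Real.log_neg ht0 ht1)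
  -- With this `ε`, `t ^ (ε P) = exp (-P lam / (4R))`: Markov's inequality gives back half of the
  -- decay rate `lam / (2R)`.
  set ε : ℝ := lam / (4 * R) / -Real.log t with hε
  have hε0 : 0 < ε := by positivity
  refine ⟨c₀ * ε, by positivity, fun P => ?_⟩
  have hbad : ∀ s : Fin P → α, (¬ ∀ x, c₀ * ε * P * ‖x‖ ^ 2 ≤ ∑ i, ‖L (s i) x‖ ^ 2) →
      1 ≤ Real.exp (P * (lam / (4 * R))) * t ^ restartCount L P ∅ s := by
    intro s hs
    have hN : (restartCount L P ∅ s : ℝ) ≤ ε * P := by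
      by_contra! hN
      refine hs fun x => ?_
      have h := restartCount_mul_le L hc P ∅ s x
      rw [Finset.sum_empty, zero_add] at h
      refine le_trans ?_ h
      have : ε * P * (c₀ * ‖x‖ ^ 2) ≤ restartCount L P ∅ s * (c₀ * ‖x‖ ^ 2) :=
        mul_le_mul_of_nonneg_right hN.le (by positivity)
      linarith
    rw [← Real.exp_log ht0, ← Real.exp_nat_mul, ← Real.exp_add]
    refine Real.one_le_exp ?_
    have h1 : ε * -Real.log t = lam / (4 * R) := div_mul_cancel₀ _ hlog.ne'
    have h2 := mul_le_mul_of_nonneg_right hN hlog.le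
    rw [← h1]
    linarith
  have hprod : ∀ s : Fin P → α, 0 ≤ ∏ i, p (s i) := fun s => Finset.prod_nonneg fun i _ => hp _
  have hρ : 0 ≤ 1 - lam / (2 * R) := by
    rw [sub_nonneg, div_le_one (by positivity)]; linarith
  calc _ ≤ ∑ s : Fin P → α with ¬ ∀ x, c₀ * ε * P * ‖x‖ ^ 2 ≤ ∑ i, ‖L (s i) x‖ ^ 2,
        Real.exp (P * (lam / (4 * R))) * ((∏ i, p (s i)) * t ^ restartCount L P ∅ s) := by
        refine Finset.sum_le_sum fun s hs => ?_
        have := mul_le_mul_of_nonneg_left (hbad s (Finset.mem_filter.mp hs).2) (hprod s)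
        linarith
    _ ≤ ∑ s : Fin P → α,
        Real.exp (P * (lam / (4 * R))) * ((∏ i, p (s i)) * t ^ restartCount L P ∅ s) :=
        Finset.sum_le_sum_of_subset_of_nonneg (Finset.filter_subset _ _) fun s _ _ =>
          mul_nonneg (Real.exp_pos _).le (mul_nonneg (hprod s) (pow_nonneg ht0.le _))
    _ ≤ Real.exp (P * (lam / (4 * R))) *
        (Real.exp (-(P * (lam / (2 * R)))) * Module.finrank ℝ E) := by
        rw [← Finset.mul_sum]
        refine mul_le_mul_of_nonneg_left ?_ (Real.exp_pos _).le
        have h := sum_prod_mul_pow_restartCount_le p hp hp1 L hR hlam0 hle hL hlam P ∅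
          (by rw [commonKer_empty]; exact top_ne_bot)
        rw [commonKer_empty, finrank_top] at h
        refine h.trans (mul_le_mul_of_nonneg_right ?_ (Nat.cast_nonneg _))
        rw [← mul_neg, Real.exp_nat_mul]
        refine pow_le_pow_left₀ hρ ?_ P
        linarith [Real.add_one_le_exp (-(lam / (2 * R)))]
    _ = _ := by
        rw [← mul_assoc, ← Real.exp_add, mul_comm]
        congr 2
        field_simp
        ring

end KernelProcess

/-! ### Ridge duality and deterministic bounds on the optimal value -/

section Ridge

/-- Weak duality: the gap is half of `‖∑ T uᵢ - y + β z‖² + β ∑ ‖uᵢ - Lᵢ z‖²`. -/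
theorem ridge_dual_le {ι E F : Type*} [Fintype ι] [NormedAddCommGroup E] [InnerProductSpace ℝ E]
    [NormedAddCommGroup F] [InnerProductSpace ℝ F] (T : ι → F → E) (L : ι → E → F)
    (hT : ∀ i u z, inner ℝ (T i u) z = inner ℝ u (L i z)) {β : ℝ} (hβ : 0 ≤ β) (y z : E)
    (u : ι → F) :
    β * inner ℝ z y - β / 2 * (β * ‖z‖ ^ 2 + ∑ i, ‖L i z‖ ^ 2) ≤
      (1 / 2) * ‖(∑ i, T i (u i)) - y‖ ^ 2 + (β / 2) * ∑ i, ‖u i‖ ^ 2 := by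
  have h1 : 0 ≤ ‖((∑ i, T i (u i)) - y) + β • z‖ ^ 2 := sq_nonneg _
  rw [norm_add_sq_real, inner_smul_right, inner_sub_left, sum_inner, norm_smul, mul_pow,
    Real.norm_eq_abs, sq_abs, real_inner_comm z y] at h1
  have h2 : 0 ≤ ∑ i, ‖u i - L i z‖ ^ 2 := Finset.sum_nonneg fun i _ => sq_nonneg _
  simp_rw [norm_sub_sq_real, ← hT] at h2
  rw [Finset.sum_add_distrib, Finset.sum_sub_distrib, ← Finset.mul_sum] at h2
  have h3 := mul_nonneg hβ h2
  linarith

variable {n d P : ℕ}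

/-- The linear map `v ↦ Xᵀ D v`. -/
noncomputable def maskMap (X : Matrix (Fin n) (Fin d) ℝ) (D : Matrix (Fin n) (Fin n) ℝ) :
    EuclideanSpace ℝ (Fin n) →ₗ[ℝ] EuclideanSpace ℝ (Fin d) :=
  Matrix.toEuclideanLin (Xᵀ * D)

theorem ofLp_maskMap (X : Matrix (Fin n) (Fin d) ℝ) (D : Matrix (Fin n) (Fin n) ℝ)
    (z : EuclideanSpace ℝ (Fin n)) : (maskMap X D z).ofLp = (Xᵀ * D) *ᵥ z.ofLp := rfl

theorem inner_eq_dotProduct {m : ℕ} (x y : EuclideanSpace ℝ (Fin m)) :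
    inner ℝ x y = x.ofLp ⬝ᵥ y.ofLp := by
  rw [EuclideanSpace.inner_eq_star_dotProduct, dotProduct_comm]; simp

theorem inner_mulVec_eq_inner_maskMap (X : Matrix (Fin n) (Fin d) ℝ)
    {D : Matrix (Fin n) (Fin n) ℝ} (hD : Dᵀ = D) (u : EuclideanSpace ℝ (Fin d))
    (z : EuclideanSpace ℝ (Fin n)) :
    inner ℝ (WithLp.toLp 2 ((D * X) *ᵥ u.ofLp)) z = inner ℝ u (maskMap X D z) := by
  rw [inner_eq_dotProduct, inner_eq_dotProduct, ofLp_maskMap, Matrix.dotProduct_mulVec,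
    ← Matrix.mulVec_transpose, Matrix.transpose_mul, Matrix.transpose_transpose, hD]

theorem dotProduct_maskGram_mulVec (X : Matrix (Fin n) (Fin d) ℝ)
    {D : Matrix (Fin n) (Fin n) ℝ} (hD : Dᵀ = D) (w z : EuclideanSpace ℝ (Fin n)) :
    w.ofLp ⬝ᵥ ((D * (X * Xᵀ) * D) *ᵥ z.ofLp) = inner ℝ (maskMap X D w) (maskMap X D z) := by
  rw [real_inner_comm, ← inner_mulVec_eq_inner_maskMap X hD, inner_eq_dotProduct, ofLp_maskMap,
    dotProduct_comm, Matrix.mulVec_mulVec]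
  simp only [Matrix.mul_assoc]

theorem transpose_pattern (X : Matrix (Fin n) (Fin d) ℝ) (g : EuclideanSpace ℝ (Fin d)) :
    (pattern X g)ᵀ = pattern X g := Matrix.diagonal_transpose _

theorem ridge_dual_le_l2Objective (X : Matrix (Fin n) (Fin d) ℝ) (y z : EuclideanSpace ℝ (Fin n))
    {β : ℝ} (hβ : 0 ≤ β) (g u : Fin P → EuclideanSpace ℝ (Fin d)) :
    β * inner ℝ z y - β / 2 * (β * ‖z‖ ^ 2 + ∑ i, ‖maskMap X (pattern X (g i)) z‖ ^ 2) ≤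
      l2Objective X y β g u := by
  have h := ridge_dual_le (fun i v => WithLp.toLp 2 ((pattern X (g i) * X) *ᵥ v.ofLp))
    (fun i v => maskMap X (pattern X (g i)) v)
    (fun i u z => inner_mulVec_eq_inner_maskMap X (transpose_pattern X (g i)) u z) hβ y z u
  rw [l2Objective]
  exact h

/-- The regularized Gram matrix `β I + ∑ᵢ Dᵢ X Xᵀ Dᵢ`. -/
noncomputable def ridgeMatrix (X : Matrix (Fin n) (Fin d) ℝ) (β : ℝ)
    (g : Fin P → EuclideanSpace ℝ (Fin d)) : Matrix (Fin n) (Fin n) ℝ :=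
  β • (1 : Matrix (Fin n) (Fin n) ℝ) + (P : ℝ) • sampleGram X g

theorem dotProduct_ridgeMatrix_mulVec (X : Matrix (Fin n) (Fin d) ℝ) (β : ℝ)
    (g : Fin P → EuclideanSpace ℝ (Fin d)) (w z : EuclideanSpace ℝ (Fin n)) :
    w.ofLp ⬝ᵥ (ridgeMatrix X β g *ᵥ z.ofLp) = β * inner ℝ w z +
      ∑ i, inner ℝ (maskMap X (pattern X (g i)) w) (maskMap X (pattern X (g i)) z) := by
  have h : (P : ℝ) • sampleGram X g = ∑ i, maskedGram X (g i) := by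
    -- For `P = 0` the factor `1 / P` is `0`, but the sum is empty as well.
    rcases P.eq_zero_or_pos with rfl | hP
    · simp
    · have : (P : ℝ) ≠ 0 := by exact_mod_cast hP.ne'
      rw [sampleGram, smul_smul, mul_one_div_cancel this, one_smul]
  rw [ridgeMatrix, h, Matrix.add_mulVec, dotProduct_add, Matrix.smul_mulVec, Matrix.one_mulVec,
    dotProduct_smul, smul_eq_mul, inner_eq_dotProduct, Matrix.sum_mulVec, dotProduct_sum]
  congr 1
  exact Finset.sum_congr rfl fun i _ => dotProduct_maskGram_mulVec X (transpose_pattern X _) w z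

theorem isUnit_ridgeMatrix (X : Matrix (Fin n) (Fin d) ℝ) {β : ℝ} (hβ : 0 < β)
    (g : Fin P → EuclideanSpace ℝ (Fin d)) : IsUnit (ridgeMatrix X β g) := by
  rw [← Matrix.mulVec_injective_iff_isUnit]
  refine (injective_iff_map_eq_zero (ridgeMatrix X β g).mulVecLin).mpr fun v hv => ?_
  have h := dotProduct_ridgeMatrix_mulVec X β g (WithLp.toLp 2 v) (WithLp.toLp 2 v)
  rw [Matrix.mulVecLin_apply] at hv
  simp only [hv, dotProduct_zero, real_inner_self_eq_norm_sq] at h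
  have h1 : 0 ≤ ∑ i, ‖maskMap X (pattern X (g i)) (WithLp.toLp 2 v)‖ ^ 2 :=
    Finset.sum_nonneg fun _ _ => sq_nonneg _
  have h2 : ‖WithLp.toLp 2 v‖ ^ 2 = 0 :=
    le_antisymm (by nlinarith) (sq_nonneg _)
  simpa using h2

/-- The dual solution `(β I + ∑ᵢ Dᵢ X Xᵀ Dᵢ)⁻¹ y`. -/
noncomputable def ridgeDual (X : Matrix (Fin n) (Fin d) ℝ) (y : EuclideanSpace ℝ (Fin n)) (β : ℝ)
    (g : Fin P → EuclideanSpace ℝ (Fin d)) : EuclideanSpace ℝ (Fin n) :=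
  WithLp.toLp 2 ((ridgeMatrix X β g)⁻¹ *ᵥ y.ofLp)

theorem inner_eq_ridgeDual (X : Matrix (Fin n) (Fin d) ℝ) (y : EuclideanSpace ℝ (Fin n)) {β : ℝ}
    (hβ : 0 < β) (g : Fin P → EuclideanSpace ℝ (Fin d)) (w : EuclideanSpace ℝ (Fin n)) :
    inner ℝ w y = β * inner ℝ w (ridgeDual X y β g) +
      ∑ i, inner ℝ (maskMap X (pattern X (g i)) w)
        (maskMap X (pattern X (g i)) (ridgeDual X y β g)) := by
  rw [← dotProduct_ridgeMatrix_mulVec, ridgeDual, Matrix.mulVec_mulVec,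
    Matrix.mul_nonsing_inv _ ((Matrix.isUnit_iff_isUnit_det _).mp (isUnit_ridgeMatrix X hβ g)),
    Matrix.one_mulVec, inner_eq_dotProduct]

theorem inner_ridgeDual (X : Matrix (Fin n) (Fin d) ℝ) (y : EuclideanSpace ℝ (Fin n)) {β : ℝ}
    (hβ : 0 < β) (g : Fin P → EuclideanSpace ℝ (Fin d)) :
    inner ℝ (ridgeDual X y β g) y = β * ‖ridgeDual X y β g‖ ^ 2 +
      ∑ i, ‖maskMap X (pattern X (g i)) (ridgeDual X y β g)‖ ^ 2 := by
  rw [inner_eq_ridgeDual X y hβ g]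
  simp only [real_inner_self_eq_norm_sq]

theorem l2Objective_maskMap_ridgeDual (X : Matrix (Fin n) (Fin d) ℝ)
    (y : EuclideanSpace ℝ (Fin n)) {β : ℝ} (hβ : 0 < β)
    (g : Fin P → EuclideanSpace ℝ (Fin d)) :
    l2Objective X y β g (fun i => maskMap X (pattern X (g i)) (ridgeDual X y β g)) =
      (β / 2) * inner ℝ (ridgeDual X y β g) y := by
  set z := ridgeDual X y β g with hz
  have hres : (∑ i, WithLp.toLp 2 ((pattern X (g i) * X) *ᵥ
      (maskMap X (pattern X (g i)) z).ofLp)) - y = -(β • z) := by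
    refine ext_inner_left ℝ fun w => ?_
    rw [inner_sub_right, inner_sum, inner_eq_ridgeDual X y hβ g, inner_neg_right, inner_smul_right]
    simp_rw [real_inner_comm _ w,
      inner_mulVec_eq_inner_maskMap X (transpose_pattern X _), ← hz,
      fun i => real_inner_comm (maskMap X (pattern X (g i)) w) (maskMap X (pattern X (g i)) z)]
    ring
  rw [l2Objective, hres, norm_neg, norm_smul, mul_pow, Real.norm_eq_abs, sq_abs,
    inner_ridgeDual X y hβ g]
  ring

theorem isLeast_l2OptVal (X : Matrix (Fin n) (Fin d) ℝ) (y : EuclideanSpace ℝ (Fin n)) {β : ℝ}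
    (hβ : 0 < β) (g : Fin P → EuclideanSpace ℝ (Fin d)) :
    IsLeast (Set.range (l2Objective X y β g)) (l2OptVal X y β g) ∧
      l2OptVal X y β g = (β / 2) * inner ℝ (ridgeDual X y β g) y := by
  have hleast : IsLeast (Set.range (l2Objective X y β g))
      ((β / 2) * inner ℝ (ridgeDual X y β g) y) := by
    refine ⟨⟨_, l2Objective_maskMap_ridgeDual X y hβ g⟩, ?_⟩
    rintro _ ⟨u, rfl⟩
    have h := ridge_dual_le_l2Objective X y (ridgeDual X y β g) hβ.le g u
    rw [← inner_ridgeDual X y hβ g] at h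
    linarith
  have hval : l2OptVal X y β g = (β / 2) * inner ℝ (ridgeDual X y β g) y := hleast.csInf_eq
  exact ⟨hval ▸ hleast, hval⟩

theorem le_l2OptVal (X : Matrix (Fin n) (Fin d) ℝ) (y : EuclideanSpace ℝ (Fin n)) {β R : ℝ}
    (hβ : 0 < β) (hR : 0 ≤ R) (g : Fin P → EuclideanSpace ℝ (Fin d))
    (hX : ∀ i z, ‖maskMap X (pattern X (g i)) z‖ ^ 2 ≤ R * ‖z‖ ^ 2) :
    (β / 2) * ‖y‖ ^ 2 / (β + P * R) ≤ l2OptVal X y β g := by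
  refine le_ciInf fun u => ?_
  have hq : 0 < β + P * R := by positivity
  -- This `z` would be the exact dual solution if the Gram sum were `P R I`.
  refine le_trans ?_ (ridge_dual_le_l2Objective X y ((β + P * R)⁻¹ • y) hβ.le g u)
  have hsum : ∑ i, ‖maskMap X (pattern X (g i)) ((β + P * R)⁻¹ • y)‖ ^ 2 ≤
      P * R * ‖(β + P * R)⁻¹ • y‖ ^ 2 := by
    refine (Finset.sum_le_sum fun i _ => hX i _).trans_eq ?_
    rw [Finset.sum_const, Finset.card_univ, Fintype.card_fin, nsmul_eq_mul]; ring
  have hbound := mul_le_mul_of_nonneg_left hsum (half_pos hβ).le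
  have hnorm : ‖(β + P * R)⁻¹ • y‖ ^ 2 = ((β + P * R)⁻¹) ^ 2 * ‖y‖ ^ 2 := by
    rw [norm_smul, mul_pow, Real.norm_eq_abs, sq_abs]
  have hcancel : (β + P * R) * ((β + P * R)⁻¹) ^ 2 = (β + P * R)⁻¹ := by field_simp
  have heq : (β / 2) * ((β + P * R) * (((β + P * R)⁻¹) ^ 2 * ‖y‖ ^ 2)) =
      (β / 2) * ((β + P * R)⁻¹ * ‖y‖ ^ 2) := by rw [← mul_assoc (β + P * R), hcancel]
  rw [inner_smul_left, real_inner_self_eq_norm_sq, hnorm, div_eq_mul_inv]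
  rw [hnorm] at hbound
  simp only [conj_trivial]
  linarith

theorem l2OptVal_le (X : Matrix (Fin n) (Fin d) ℝ) (y : EuclideanSpace ℝ (Fin n)) {β q : ℝ}
    (hβ : 0 < β) (hq : 0 < q) (g : Fin P → EuclideanSpace ℝ (Fin d))
    (hX : ∀ z, q * ‖z‖ ^ 2 ≤ ∑ i, ‖maskMap X (pattern X (g i)) z‖ ^ 2) :
    l2OptVal X y β g ≤ (β / 2) * ‖y‖ ^ 2 / q := by
  rw [(isLeast_l2OptVal X y hβ g).2, mul_div_assoc]
  refine mul_le_mul_of_nonneg_left ?_ (half_pos hβ).le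
  set z := ridgeDual X y β g with hz
  have h1 : q * ‖z‖ ^ 2 ≤ inner ℝ z y := by
    rw [inner_ridgeDual X y hβ g]
    have := hX z
    have : 0 ≤ β * ‖z‖ ^ 2 := by positivity
    linarith
  have h2 := real_inner_le_norm z y
  rw [le_div_iff₀ hq]
  -- `2q⟨z,y⟩ ≤ 2q‖z‖‖y‖ ≤ q²‖z‖² + ‖y‖² ≤ q⟨z,y⟩ + ‖y‖²`.
  nlinarith [sq_nonneg (q * ‖z‖ - ‖y‖)]

end Ridge

/-! ### Rayleigh quotient bounds for extreme eigenvalues -/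

section Rayleigh

variable {n d : ℕ} {A : Matrix (Fin n) (Fin n) ℝ}

theorem lambdaMin_mul_dotProduct_le (hA : A.IsHermitian) (v : Fin n → ℝ) :
    lambdaMin A * (v ⬝ᵥ v) ≤ v ⬝ᵥ (A *ᵥ v) := by
  have h : (A - algebraMap ℝ _ (lambdaMin A)).PosSemidef := by
    rw [Matrix.posSemidef_iff_isHermitian_and_spectrum_nonneg]
    refine ⟨hA.sub (by simp [Matrix.IsHermitian, Matrix.algebraMap_eq_diagonal]), ?_⟩
    rw [← spectrum.sub_singleton_eq]
    rintro _ ⟨x, hx, _, rfl, rfl⟩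
    exact sub_nonneg.mpr (csInf_le A.finite_real_spectrum.bddBelow hx)
  have := h.dotProduct_mulVec_nonneg v
  rw [Algebra.algebraMap_eq_smul_one, star_trivial, Matrix.sub_mulVec, Matrix.smul_mulVec,
    Matrix.one_mulVec, dotProduct_sub, dotProduct_smul, smul_eq_mul] at this
  linarith

theorem dotProduct_le_lambdaMax_mul (hA : A.IsHermitian) (v : Fin n → ℝ) :
    v ⬝ᵥ (A *ᵥ v) ≤ lambdaMax A * (v ⬝ᵥ v) := by
  have h : (algebraMap ℝ _ (lambdaMax A) - A).PosSemidef := by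
    rw [Matrix.posSemidef_iff_isHermitian_and_spectrum_nonneg]
    refine ⟨Matrix.IsHermitian.sub
      (by simp [Matrix.IsHermitian, Matrix.algebraMap_eq_diagonal]) hA, ?_⟩
    rw [← spectrum.singleton_sub_eq]
    rintro _ ⟨_, rfl, x, hx, rfl⟩
    exact sub_nonneg.mpr (le_csSup A.finite_real_spectrum.bddAbove hx)
  have := h.dotProduct_mulVec_nonneg v
  rw [Algebra.algebraMap_eq_smul_one, star_trivial, Matrix.sub_mulVec, Matrix.smul_mulVec,
    Matrix.one_mulVec, dotProduct_sub, dotProduct_smul, smul_eq_mul] at this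
  linarith

theorem lambdaMin_pos (hn : 0 < n) (hA : A.PosSemidef) (hunit : IsUnit A) : 0 < lambdaMin A := by
  have hmem : lambdaMin A ∈ spectrum ℝ A :=
    Set.Nonempty.csInf_mem ⟨_, hA.isHermitian.eigenvalues_mem_spectrum_real ⟨0, hn⟩⟩
      A.finite_real_spectrum
  refine lt_of_le_of_ne
    ((Matrix.posSemidef_iff_isHermitian_and_spectrum_nonneg.mp hA).2 hmem) fun h => ?_
  exact (spectrum.zero_notMem_iff ℝ).mpr hunit (h ▸ hmem)

end Rayleigh

/-! ### Reduction from Gaussian gates to the finite law of activation patterns -/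

section Patterns

variable {n d P : ℕ}

/-- The activation pattern of the gate vector `g`, as a vector of Booleans. -/
noncomputable def signPattern (X : Matrix (Fin n) (Fin d) ℝ) (g : EuclideanSpace ℝ (Fin d)) : Fin n → Bool :=
  fun i => decide (0 ≤ (X *ᵥ g.ofLp) i)

/-- The diagonal matrix of a Boolean vector. -/
noncomputable def boolDiag (a : Fin n → Bool) : Matrix (Fin n) (Fin n) ℝ :=
  Matrix.diagonal fun i => if a i then 1 else 0

theorem boolDiag_signPattern (X : Matrix (Fin n) (Fin d) ℝ) (g : EuclideanSpace ℝ (Fin d)) :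
    boolDiag (signPattern X g) = pattern X g := by
  simp [boolDiag, signPattern, pattern]

theorem transpose_boolDiag (a : Fin n → Bool) : (boolDiag a)ᵀ = boolDiag a :=
  Matrix.diagonal_transpose _

theorem measurable_signPattern (X : Matrix (Fin n) (Fin d) ℝ) : Measurable (signPattern X) := by
  refine measurable_pi_lambda _ fun i => measurable_to_bool ?_
  have hcont : Continuous fun g : EuclideanSpace ℝ (Fin d) => (X *ᵥ g.ofLp) i := by
    simp only [Matrix.mulVec, dotProduct]
    fun_prop
  have : (fun g => signPattern X g i) ⁻¹' {true} =
      {g : EuclideanSpace ℝ (Fin d) | 0 ≤ (X *ᵥ g.ofLp) i} := by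
    ext g; simp [signPattern]
  rw [this]
  exact measurableSet_le measurable_const hcont.measurable

/-- The probability of an activation pattern under a standard Gaussian gate vector. -/
noncomputable def patternProb (X : Matrix (Fin n) (Fin d) ℝ) (a : Fin n → Bool) : ℝ :=
  (stdGaussian (EuclideanSpace ℝ (Fin d))).real {g | signPattern X g = a}

theorem measurableSet_signPattern_eq (X : Matrix (Fin n) (Fin d) ℝ) (a : Fin n → Bool) :
    MeasurableSet {g | signPattern X g = a} :=
  measurable_signPattern X (measurableSet_singleton a)

theorem integral_comp_signPattern (X : Matrix (Fin n) (Fin d) ℝ) (f : (Fin n → Bool) → ℝ) :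
    ∫ g, f (signPattern X g) ∂(stdGaussian (EuclideanSpace ℝ (Fin d))) =
      ∑ a, patternProb X a * f a := by
  have hm := measurable_signPattern X
  have : IsProbabilityMeasure ((stdGaussian (EuclideanSpace ℝ (Fin d))).map (signPattern X)) :=
    Measure.isProbabilityMeasure_map hm.aemeasurable
  rw [← integral_map hm.aemeasurable (measurable_of_finite f).aestronglyMeasurable,
    integral_fintype .of_finite]
  refine Finset.sum_congr rfl fun a _ => ?_
  rw [smul_eq_mul, map_measureReal_apply hm (measurableSet_singleton a)]
  rfl

theorem sum_patternProb (X : Matrix (Fin n) (Fin d) ℝ) : ∑ a, patternProb X a = 1 := by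
  simpa using (integral_comp_signPattern X fun _ => 1).symm

theorem expectedGram_eq_sum (X : Matrix (Fin n) (Fin d) ℝ) :
    expectedGram X = ∑ a, patternProb X a • (boolDiag a * (X * Xᵀ) * boolDiag a) := by
  ext i j
  rw [Matrix.sum_apply]
  simp only [Matrix.smul_apply, smul_eq_mul]
  rw [← integral_comp_signPattern X fun a => (boolDiag a * (X * Xᵀ) * boolDiag a) i j]
  simp only [boolDiag_signPattern]
  rfl

theorem dotProduct_expectedGram_mulVec (X : Matrix (Fin n) (Fin d) ℝ)
    (w z : EuclideanSpace ℝ (Fin n)) :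
    w.ofLp ⬝ᵥ (expectedGram X *ᵥ z.ofLp) =
      ∑ a, patternProb X a * inner ℝ (maskMap X (boolDiag a) w) (maskMap X (boolDiag a) z) := by
  rw [expectedGram_eq_sum, Matrix.sum_mulVec, dotProduct_sum]
  refine Finset.sum_congr rfl fun a _ => ?_
  rw [Matrix.smul_mulVec, dotProduct_smul, smul_eq_mul,
    dotProduct_maskGram_mulVec X (transpose_boolDiag a)]

theorem posSemidef_expectedGram (X : Matrix (Fin n) (Fin d) ℝ) : (expectedGram X).PosSemidef := by
  refine .of_dotProduct_mulVec_nonneg ?_ fun v => ?_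
  · rw [expectedGram_eq_sum, Matrix.IsHermitian, Matrix.conjTranspose_eq_transpose_of_trivial,
      Matrix.transpose_sum]
    refine Finset.sum_congr rfl fun a _ => ?_
    simp [Matrix.transpose_mul, transpose_boolDiag, Matrix.mul_assoc]
  · have h := dotProduct_expectedGram_mulVec X (WithLp.toLp 2 v) (WithLp.toLp 2 v)
    simp only [real_inner_self_eq_norm_sq] at h
    rw [star_trivial, h]
    exact Finset.sum_nonneg fun a _ => mul_nonneg measureReal_nonneg (sq_nonneg _)

theorem norm_sq_maskMap_boolDiag_le (X : Matrix (Fin n) (Fin d) ℝ) (a : Fin n → Bool)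
    (v : EuclideanSpace ℝ (Fin n)) :
    ‖maskMap X (boolDiag a) v‖ ^ 2 ≤ lambdaMax (X * Xᵀ) * ‖v‖ ^ 2 := by
  have hherm : (X * Xᵀ).IsHermitian := by
    rw [Matrix.IsHermitian, Matrix.conjTranspose_eq_transpose_of_trivial, Matrix.transpose_mul,
      Matrix.transpose_transpose]
  have hpsd : (X * Xᵀ).PosSemidef := by
    simpa using Matrix.posSemidef_self_mul_conjTranspose X
  have hR : 0 ≤ lambdaMax (X * Xᵀ) := by
    refine Real.sSup_nonneg fun x hx => ?_
    exact (Matrix.posSemidef_iff_isHermitian_and_spectrum_nonneg.mp hpsd).2 hx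
  have h1 := dotProduct_le_lambdaMax_mul hherm (boolDiag a *ᵥ v.ofLp)
  have h2 : (boolDiag a *ᵥ v.ofLp) ⬝ᵥ ((X * Xᵀ) *ᵥ (boolDiag a *ᵥ v.ofLp)) =
      ‖maskMap X (boolDiag a) v‖ ^ 2 := by
    rw [← real_inner_self_eq_norm_sq, ← dotProduct_maskGram_mulVec X (transpose_boolDiag a),
      Matrix.mul_assoc, ← Matrix.mulVec_mulVec v.ofLp (boolDiag a),
      Matrix.dotProduct_mulVec v.ofLp, ← Matrix.mulVec_transpose, transpose_boolDiag,
      ← Matrix.mulVec_mulVec v.ofLp (X * Xᵀ)]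
  have h3 : (boolDiag a *ᵥ v.ofLp) ⬝ᵥ (boolDiag a *ᵥ v.ofLp) ≤ ‖v‖ ^ 2 := by
    rw [← real_inner_self_eq_norm_sq, inner_eq_dotProduct]
    refine Finset.sum_le_sum fun i _ => ?_
    rw [boolDiag, Matrix.mulVec_diagonal]
    split_ifs
    · simp
    · simpa using mul_self_nonneg (v.ofLp i)
  rw [h2] at h1
  exact h1.trans (mul_le_mul_of_nonneg_left h3 hR)

theorem lambdaMin_mul_norm_sq_le (X : Matrix (Fin n) (Fin d) ℝ) (v : EuclideanSpace ℝ (Fin n)) :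
    lambdaMin (expectedGram X) * ‖v‖ ^ 2 ≤
      ∑ a, patternProb X a * ‖maskMap X (boolDiag a) v‖ ^ 2 := by
  have h := lambdaMin_mul_dotProduct_le (posSemidef_expectedGram X).isHermitian v.ofLp
  rw [dotProduct_expectedGram_mulVec, ← inner_eq_dotProduct] at h
  simpa only [real_inner_self_eq_norm_sq] using h

theorem measureReal_signPattern_eq {Ω : Type*} [MeasurableSpace Ω] {μ : Measure Ω}
    (X : Matrix (Fin n) (Fin d) ℝ) {g : Fin P → Ω → EuclideanSpace ℝ (Fin d)}
    (hlaw : ∀ i, HasLaw (g i) (stdGaussian (EuclideanSpace ℝ (Fin d))) μ)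
    (hind : iIndepFun g μ) (s : Fin P → Fin n → Bool) :
    μ.real {ω | ∀ i, signPattern X (g i ω) = s i} = ∏ i, patternProb X (s i) := by
  have h := hind.measure_inter_preimage_eq_mul Finset.univ
    (sets := fun i => {x | signPattern X x = s i})
    fun i _ => measurableSet_signPattern_eq X (s i)
  have hset : {ω | ∀ i, signPattern X (g i ω) = s i} =
      ⋂ i ∈ Finset.univ, g i ⁻¹' {x | signPattern X x = s i} := by
    ext ω; simp
  rw [hset, measureReal_def, h, ENNReal.toReal_prod]
  exact Finset.prod_congr rfl fun i _ =>
    (hlaw i).measureReal_eq (measurableSet_signPattern_eq X (s i))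

-- A union bound over bad pattern sequences; subadditivity alone suffices, so `G` need not be
-- measurable.
open Classical in
theorem one_sub_sum_le_measureReal {Ω : Type*} [MeasurableSpace Ω] {μ : Measure Ω}
    [IsProbabilityMeasure μ] (X : Matrix (Fin n) (Fin d) ℝ)
    {g : Fin P → Ω → EuclideanSpace ℝ (Fin d)}
    (hlaw : ∀ i, HasLaw (g i) (stdGaussian (EuclideanSpace ℝ (Fin d))) μ)
    (hind : iIndepFun g μ) (Good : (Fin P → Fin n → Bool) → Prop) (G : Set Ω)
    (hG : ∀ ω, Good (fun i => signPattern X (g i ω)) → ω ∈ G) :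
    1 - ∑ s with ¬ Good s, ∏ i, patternProb X (s i) ≤ μ.real G := by
  have hcover : (Set.univ : Set Ω) ⊆ G ∪ ⋃ s ∈ Finset.univ.filter fun s => ¬ Good s,
      {ω | ∀ i, signPattern X (g i ω) = s i} := by
    intro ω _
    by_cases h : Good fun i => signPattern X (g i ω)
    · exact Or.inl (hG ω h)
    · refine Or.inr ?_
      simp only [Set.mem_iUnion]
      exact ⟨_, by simpa using h, fun _ => rfl⟩
  have h1 := (measureReal_mono (μ := μ) hcover).trans (measureReal_union_le _ _)
  have h2 := measureReal_biUnion_finset_le (μ := μ) (Finset.univ.filter fun s => ¬ Good s)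
    fun s => {ω | ∀ i, signPattern X (g i ω) = s i}
  simp_rw [measureReal_signPattern_eq X hlaw hind] at h2
  rw [probReal_univ] at h1
  linarith

end Patterns

/-! ### Sample size and the main theorem -/

theorem mul_exp_le_of_twelve_mul_log_le {n : ℕ} (hn : 0 < n) {κ δ P : ℝ} (hκ : 0 < κ)
    (hδ : 0 < δ) (hδ1 : δ < 1) (hP : 12 * κ * Real.log (2 * n / δ) ≤ P) :
    n * Real.exp (-(P * (1 / (4 * κ)))) ≤ δ := by
  have hn1 : (1 : ℝ) ≤ n := by exact_mod_cast hn
  have hx : 0 < 2 * n / δ := by positivity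
  have hlog : 0 ≤ Real.log (2 * n / δ) := Real.log_nonneg (by rw [le_div_iff₀ hδ]; linarith)
  have h1 : Real.log (2 * n / δ) ≤ P * (1 / (4 * κ)) := by
    rw [mul_one_div, le_div_iff₀ (by positivity)]
    -- The constant `4` would already do; `12` leaves slack.
    nlinarith [mul_nonneg hκ.le hlog]
  calc n * Real.exp (-(P * (1 / (4 * κ)))) ≤ n * Real.exp (-Real.log (2 * n / δ)) := by gcongr
    _ = δ / 2 := by
      rw [Real.exp_neg, Real.exp_log hx]
      field_simp
    _ ≤ δ := by linarith

end GatedRelu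

theorem theorem3p4 {n d : ℕ} (X : Matrix (Fin n) (Fin d) ℝ) (y : EuclideanSpace ℝ (Fin n)) (β : ℝ)
    (hβ : 0 < β) (hy : y ≠ 0) (hM : IsUnit (GatedRelu.expectedGram X)) :
    (∀ (P : ℕ) (g : Fin P → EuclideanSpace ℝ (Fin d)),
      IsLeast (Set.range (GatedRelu.l2Objective X y β g)) (GatedRelu.l2OptVal X y β g) ∧
      IsUnit (β • (1 : Matrix (Fin n) (Fin n) ℝ) + (P : ℝ) • GatedRelu.sampleGram X g) ∧
      GatedRelu.l2OptVal X y β g =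
        (β / 2) * (y.ofLp ⬝ᵥ
          ((β • (1 : Matrix (Fin n) (Fin n) ℝ) + (P : ℝ) • GatedRelu.sampleGram X g)⁻¹
            *ᵥ y.ofLp))) ∧
    ∃ C₁ C₂ : ℝ, 0 < C₁ ∧ 0 < C₂ ∧
      ∀ (δ : ℝ), 0 < δ → δ < 1 →
      ∀ (P : ℕ), 12 * GatedRelu.kappa X * Real.log (2 * (n : ℝ) / δ) ≤ (P : ℝ) →
      ∀ (Ω : Type*) [MeasurableSpace Ω] (μ : Measure Ω) [IsProbabilityMeasure μ]
        (g : Fin P → Ω → EuclideanSpace ℝ (Fin d)),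
        (∀ i, HasLaw (g i) (stdGaussian (EuclideanSpace ℝ (Fin d))) μ) →
        iIndepFun g μ →
        1 - δ ≤ μ.real {ω |
          C₁ / (P : ℝ) ≤ GatedRelu.l2OptVal X y β (fun i => g i ω) ∧
          GatedRelu.l2OptVal X y β (fun i => g i ω) ≤ C₂ / (P : ℝ)} := by
  classical
  refine ⟨fun P g => ?_, ?_⟩
  · obtain ⟨hleast, hval⟩ := GatedRelu.isLeast_l2OptVal X y hβ g
    refine ⟨hleast, GatedRelu.isUnit_ridgeMatrix X hβ g, ?_⟩
    rw [hval, real_inner_comm, GatedRelu.inner_eq_dotProduct]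
    rfl
  have hn : 0 < n := by
    rcases n.eq_zero_or_pos with rfl | h
    · exact absurd (Subsingleton.elim y 0) hy
    · exact h
  have : Nonempty (Fin n) := ⟨⟨0, hn⟩⟩
  have hynorm : 0 < ‖y‖ := norm_pos_iff.mpr hy
  set R := GatedRelu.lambdaMax (X * Xᵀ) with hRdef
  set lam := GatedRelu.lambdaMin (GatedRelu.expectedGram X) with hlamdef
  have hlam0 : 0 < lam := GatedRelu.lambdaMin_pos hn (GatedRelu.posSemidef_expectedGram X) hM
  have hL := GatedRelu.norm_sq_maskMap_boolDiag_le X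
  have hlam := GatedRelu.lambdaMin_mul_norm_sq_le X
  have hp : ∀ a, 0 ≤ GatedRelu.patternProb X a := fun a => measureReal_nonneg
  -- Any nonzero test vector compares the two bounds; `y` is one.
  have hle : lam ≤ R := by
    have h : ∑ a, GatedRelu.patternProb X a * ‖GatedRelu.maskMap X (GatedRelu.boolDiag a) y‖ ^ 2 ≤
        R * ‖y‖ ^ 2 := by
      refine (Finset.sum_le_sum fun a _ => mul_le_mul_of_nonneg_left (hL a y) (hp a)).trans_eq ?_
      rw [← Finset.sum_mul, GatedRelu.sum_patternProb, one_mul]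
    exact le_of_mul_le_mul_right ((hlam y).trans h) (by positivity)
  have hR : 0 < R := hlam0.trans_le hle
  have hκ : 0 < GatedRelu.kappa X := div_pos hR hlam0
  obtain ⟨c, hc, htail⟩ := GatedRelu.exists_pos_sum_prod_filter_le (GatedRelu.patternProb X) hp
    (GatedRelu.sum_patternProb X) (fun a => GatedRelu.maskMap X (GatedRelu.boolDiag a)) hR hlam0
    hle hL hlam
  refine ⟨(β / 2) * ‖y‖ ^ 2 / (β + R), (β / 2) * ‖y‖ ^ 2 / c, by positivity, by positivity, ?_⟩
  intro δ hδ hδ1 P hP Ω _ μ _ g hlaw hind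
  have hn1 : (1 : ℝ) ≤ n := by exact_mod_cast hn
  have hP0 : (0 : ℝ) < P := by
    refine lt_of_lt_of_le (mul_pos (by positivity) (Real.log_pos ?_)) hP
    rw [lt_div_iff₀ hδ]
    linarith
  have hP1 : (1 : ℝ) ≤ P := by exact_mod_cast Nat.cast_pos.mp hP0
  have hprob : ∑ s : Fin P → Fin n → Bool with ¬ ∀ x, c * P * ‖x‖ ^ 2 ≤
      ∑ i, ‖GatedRelu.maskMap X (GatedRelu.boolDiag (s i)) x‖ ^ 2,
        ∏ i, GatedRelu.patternProb X (s i) ≤ δ := by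
    refine (htail P).trans ?_
    have hrate : lam / (4 * R) = 1 / (4 * GatedRelu.kappa X) := by
      rw [GatedRelu.kappa, ← hRdef, ← hlamdef]
      field_simp
    rw [finrank_euclideanSpace_fin, hrate]
    exact GatedRelu.mul_exp_le_of_twelve_mul_log_le hn hκ hδ hδ1 hP
  refine le_trans (sub_le_sub_left hprob 1)
    (GatedRelu.one_sub_sum_le_measureReal X hlaw hind _ _ fun ω hω => ⟨?_, ?_⟩)
  · refine le_trans ?_ (GatedRelu.le_l2OptVal X y hβ hR.le _ fun i z => ?_)
    · rw [div_div]
      refine div_le_div_of_nonneg_left (by positivity) (by positivity) ?_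
      -- As `P ≥ 1`, `β + P R ≤ P (β + R)`, which is why `C₁` has denominator `β + R`.
      nlinarith [mul_le_mul_of_nonneg_left hP1 hβ.le]
    · rw [← GatedRelu.boolDiag_signPattern]
      exact hL _ z
  · rw [div_div]
    refine GatedRelu.l2OptVal_le X y hβ (by positivity) _ fun z => ?_
    simpa only [GatedRelu.boolDiag_signPattern] using hω z
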